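/- Let $V\in C^1(\mathbb R^3)$ be complex-valued and compactly supported. Let $\lambda=k^2$ with $\operatorname{Im}k>0$, and let $R_0(\lambda)=(-\Delta-\lambda)^{-1}$ be the free resolvent, represented as the integral operator $$(R_0(\lambda)f)(x)=\int_{\mathbb R^3}\frac{e^{ik|x-y|}}{4\pi|x-y|}\,f(y)\,d^3y ,\qquad f\in L^2(\mathbb R^3).$$ Then the integral $$G_\lambda(x,y)=\frac1{16\pi^2}\int_{\mathbb R^3}\frac{e^{ik|x-z|}e^{ik|z-y|}}{|x-z|\,|z-y|}\,V(z)\,d^3z$$ converges absolutely for all $x,y\in\mathbb R^3$, it is the integral kernel of the operator $R_0(\lambda)VR_0(\lambda)$, that is, $(R_0(\lambda)VR_0(\lambda)f)(x)=\int G_\lambda(x,y)f(y)\,d^3y$ for all $f\in L^2(\mathbb R^3)$ and $x\in\mathbb R^3$ (all the integrals converging absolutely), and it satisfies, for all $x,y\in\mathbb R^3$, the estimate $$|G_\lambda(x,y)|\le\frac{2C}{\sqrt{1+4|k|}-1}$$ with the finite constant, independent of $k$, $x$ and $y$, $$C=\max\left\{\frac1{8\pi^2}\max_{x\in\mathbb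 R^3}\int_{\mathbb R^3}\frac{|V(y)|}{|x-y|}\,d^3y,\ \ \frac{\|V\|_\infty}{8\pi}+\frac{\sqrt2}{16}\,\|\nabla V\|_\infty\bigl(\operatorname{diam}(\operatorname{supp}V)+1\bigr)\right\},$$ in which the maximum over $x$ is attained. Here $\|V\|_\infty=\sup_x|V(x)|$ and $\|\nabla V\|_\infty=\sup_x\bigl(\sum_{j=1}^3|\partial_jV(x)|^2\bigr)^{1/2}$ (and the diameter of the empty set is $0$). -/

import Mathlib

open MeasureTheory

noncomputable section

namespace Schrodinger

/-- The configuration space `ℝ³` with its Euclidean norm. -/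
abbrev Space : Type := EuclideanSpace ℝ (Fin 3)

/-- The kernel `exp (i k |x - y|) / (4 π |x - y|)` of the free resolvent
`R₀(λ) = (-Δ - λ)⁻¹`, where `λ = k²` and `Im k > 0`. -/
def freeKernel (k : ℂ) (x y : Space) : ℂ :=
  Complex.exp (Complex.I * k * (‖x - y‖ : ℂ)) / (4 * (Real.pi : ℂ) * (‖x - y‖ : ℂ))

/-- The free resolvent `R₀(k²)`, as the integral operator with kernel `freeKernel k`. -/
def freeResolvent (k : ℂ) (f : Space → ℂ) (x : Space) : ℂ :=
  ∫ y, freeKernel k x y * f y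

/-- The integrand `exp (i k |x - z|) exp (i k |z - y|) / (|x - z| |z - y|) * V z`. -/
def sandwichIntegrand (k : ℂ) (V : Space → ℂ) (x y z : Space) : ℂ :=
  Complex.exp (Complex.I * k * (‖x - z‖ : ℂ)) * Complex.exp (Complex.I * k * (‖z - y‖ : ℂ)) /
    ((‖x - z‖ : ℂ) * (‖z - y‖ : ℂ)) * V z

/-- The kernel `G_λ(x, y)` of `R₀(λ) V R₀(λ)`, where `λ = k²` and `Im k > 0`. -/
def sandwichKernel (k : ℂ) (V : Space → ℂ) (x y : Space) : ℂ :=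
  1 / (16 * (Real.pi : ℂ) ^ 2) * ∫ z, sandwichIntegrand k V x y z

/-- The potential `∫ |V(y)| / |x - y| dy`. -/
def newtonPotential (V : Space → ℂ) (x : Space) : ℝ :=
  ∫ y, ‖V y‖ / ‖x - y‖

/-- The length `|∇V(x)|` of the complex gradient, `(∑ⱼ |∂ⱼV(x)|²)^(1/2)`. -/
def gradNorm (V : Space → ℂ) (x : Space) : ℝ :=
  Real.sqrt (∑ j : Fin 3, ‖fderiv ℝ V x (EuclideanSpace.single j (1 : ℝ))‖ ^ 2)

/-- The constant `C` of the kernel estimate. -/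
def kernelConstant (V : Space → ℂ) : ℝ :=
  max (1 / (8 * Real.pi ^ 2) * ⨆ x, newtonPotential V x)
    ((⨆ x, ‖V x‖) / (8 * Real.pi) +
      Real.sqrt 2 / 16 * (⨆ x, gradNorm V x) * (Metric.diam (tsupport V) + 1))

end Schrodinger

end

/-!
Write `a = |x - z|`, `b = |z - y|`, `d = |x - y|`, and let `t > 0` solve `t (t + 1) = |k|`, so that
the claimed bound is `C / t`. All claims about convergence reduce to the local integrability of
`1 / |z|²` in `ℝ³`; the kernel of `R₀ V R₀` is identified by Fubini's theorem, because `R₀` maps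
`L²` to bounded functions. The maximum of the Newton potential is attained because the potential is
continuous, being a convolution, and vanishes at infinity.

The estimate combines two bounds. If `d ≥ t`, then `1 / (a b) ≤ (1 / a + 1 / b) / d` bounds
`|G_λ(x, y)|` by `C / d ≤ C / t` (`norm_integral_sandwichIntegrand_le_newtonPotential`).

If `d ≤ t`, the oscillation of the phase `exp (i k s)`, `s = a + b`, is used. In prolate spheroidal
coordinates with foci `x` and `y` the weight `1 / (a b)` cancels against the volume element. The
coordinates are written without a choice of axes as a map `u ↦ z` of `ℝ³` (`spheroidalMap`) that
stretches the component of `u` along `x - y`, such that `s² = p² + d²` for `p = |u|`. Its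
differential is half a rank-one perturbation of the identity, which gives the Jacobian
`a b / (2 p s)` at once. With polar coordinates in `u`, the integral becomes
`1/2 ∫_{S²} ∫₀^∞ (p / s) exp (i k s) V dp dω`. Since `p / s = ds / dp`, integration by parts in `p`
gains `1 / |k|`. On the coordinate lines `z` moves with speed at most `1 / 2`, and the parameters
for which `z` lies in the support of `V` have diameter at most `2 diam (supp V) + d`. Hence
`|G_λ(x, y)| ≤ (‖V‖ + ‖∇V‖ (2 diam (supp V) + d) / 2) / (8 π |k|) ≤ (1 + t) C / |k| = C / t`
(`norm_integral_sandwichIntegrand_le_oscillation`, `norm_sandwichKernel_le`). The coordinates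
degenerate to polar ones if `x = y`, so this case needs no separate treatment.
-/

namespace Schrodinger

open Set Metric Filter Topology
open scoped RealInnerProductSpace

/-! ### The Newton potential and the gradient -/

theorem finrank_space : Module.finrank ℝ Space = 3 := by simp

/-- In dimension three the powers `|z|⁻ⁿ` with `n ≤ 2` are locally integrable, because the factor
`r²` of the volume element compensates the singularity. -/
theorem locallyIntegrable_inv_norm_pow {n : ℕ} (hn : n ≤ 2) :
    LocallyIntegrable (fun z : Space => ‖z‖⁻¹ ^ n) := by
  rw [locallyIntegrable_iff]
  intro K hK
  obtain ⟨R, hR⟩ := hK.isBounded.subset_ball 0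
  refine IntegrableOn.mono_set ?_ hR
  rw [integrableOn_fun_norm_addHaar volume (f := fun r : ℝ => r⁻¹ ^ n), finrank_space]
  have h : IntegrableOn (fun r : ℝ => r ^ (2 - n)) (Ioo 0 R) :=
    ((continuous_pow _).continuousOn.integrableOn_Icc (a := 0) (b := R)).mono_set
      Ioo_subset_Icc_self
  refine h.congr_fun (fun r hr => ?_) measurableSet_Ioo
  have hr0 : r ≠ 0 := hr.1.ne'
  simp only [smul_eq_mul, inv_pow, ← div_eq_mul_inv]
  rw [eq_div_iff (pow_ne_zero _ hr0), ← pow_add]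
  congr 1
  omega

theorem integrable_mul_inv_norm_sub_pow {W : Space → ℝ} (hW : Continuous W)
    (hW' : HasCompactSupport W) {n : ℕ} (hn : n ≤ 2) (x : Space) :
    Integrable (fun z => W z * ‖x - z‖⁻¹ ^ n) := by
  have h := (locallyIntegrable_inv_norm_pow hn).integrable_smul_left_of_hasCompactSupport
    (g := fun u => W (x - u)) (by fun_prop)
    (hW'.comp_homeomorph (Homeomorph.subLeft x))
  have h2 := h.comp_sub_left x
  simpa using h2

variable {V : Space → ℂ}

theorem integrable_norm_div_norm_sub (hV : Continuous V) (hsupp : HasCompactSupport V) (x : Space) :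
    Integrable (fun y => ‖V y‖ / ‖x - y‖) := by
  simpa [div_eq_mul_inv] using
    integrable_mul_inv_norm_sub_pow hV.norm hsupp.norm (n := 1) (by norm_num) x

theorem newtonPotential_nonneg (V : Space → ℂ) (x : Space) : 0 ≤ newtonPotential V x :=
  integral_nonneg fun _ => by positivity

/-- The Newton potential is the convolution of `|V|` with the locally integrable function
`1 / |z|`. -/
theorem continuous_newtonPotential (hV : Continuous V) (hsupp : HasCompactSupport V) :
    Continuous (newtonPotential V) := by
  have h := hsupp.norm.continuous_convolution_right (ContinuousLinearMap.mul ℝ ℝ)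
    (locallyIntegrable_inv_norm_pow (n := 1) (by norm_num)) hV.norm
  convert h using 1
  ext x
  rw [newtonPotential, convolution, ← integral_sub_left_eq_self _ _ x]
  simp [div_eq_inv_mul]

theorem tendsto_newtonPotential_cocompact (hV : Continuous V) (hsupp : HasCompactSupport V) :
    Tendsto (newtonPotential V) (cocompact Space) (𝓝 0) := by
  obtain ⟨R, hR⟩ := hsupp.isCompact.isBounded.subset_closedBall 0
  have hint : Integrable (fun y => ‖V y‖) := hV.norm.integrable_of_hasCompactSupport hsupp.norm
  have hlim : Tendsto (fun x : Space => (∫ y, ‖V y‖) * (‖x‖ - R)⁻¹) (cocompact Space) (𝓝 0) := by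
    have := (tendsto_inv_atTop_zero.comp
      (tendsto_atTop_add_const_right _ (-R) (tendsto_norm_cocompact_atTop (E := Space)))).const_mul
      (∫ y, ‖V y‖)
    simpa [Function.comp_def, sub_eq_add_neg] using this
  refine squeeze_zero' (Eventually.of_forall fun x => newtonPotential_nonneg V x) ?_ hlim
  filter_upwards [(tendsto_norm_cocompact_atTop (E := Space)).eventually_gt_atTop R] with x hx
  rw [newtonPotential, ← integral_mul_const]
  refine integral_mono (integrable_norm_div_norm_sub hV hsupp x) (hint.mul_const _) fun y => ?_
  dsimp only
  by_cases hy : V y = 0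
  · simp [hy]
  · have hy' : ‖y‖ ≤ R := by simpa using hR (subset_tsupport V hy)
    have : ‖x‖ - R ≤ ‖x - y‖ := by linarith [norm_sub_norm_le x y]
    rw [div_eq_mul_inv]
    gcongr

theorem exists_forall_newtonPotential_le (hV : Continuous V) (hsupp : HasCompactSupport V) :
    ∃ x₀, ∀ x, newtonPotential V x ≤ newtonPotential V x₀ := by
  by_cases h : ∃ x₀, 0 < newtonPotential V x₀
  · obtain ⟨x₀, hx₀⟩ := h
    exact (continuous_newtonPotential hV hsupp).exists_forall_ge' x₀
      ((tendsto_newtonPotential_cocompact hV hsupp).eventually_le_const hx₀)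
  · push Not at h
    exact ⟨0, fun x => (h x).trans (newtonPotential_nonneg V 0)⟩

theorem bddAbove_range_norm (hV : Continuous V) (hsupp : HasCompactSupport V) :
    BddAbove (range fun x => ‖V x‖) :=
  hV.norm.bddAbove_range_of_hasCompactSupport hsupp.norm

theorem gradNorm_nonneg (V : Space → ℂ) (x : Space) : 0 ≤ gradNorm V x := Real.sqrt_nonneg _

theorem bddAbove_range_gradNorm (hV : ContDiff ℝ 1 V) (hsupp : HasCompactSupport V) :
    BddAbove (range (gradNorm V)) := by
  have hc : Continuous (fderiv ℝ V) := hV.continuous_fderiv one_ne_zero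
  refine Continuous.bddAbove_range_of_hasCompactSupport ?_ ?_
  · unfold gradNorm
    fun_prop
  · refine (hsupp.fderiv ℝ).comp_left
      (g := fun L : Space →L[ℝ] ℂ =>
        Real.sqrt (∑ j : Fin 3, ‖L (EuclideanSpace.single j (1 : ℝ))‖ ^ 2)) ?_
    simp

/-- The Cauchy–Schwarz inequality for the complex gradient and a real direction. -/
theorem norm_fderiv_apply_le (V : Space → ℂ) (x v : Space) :
    ‖fderiv ℝ V x v‖ ≤ gradNorm V x * ‖v‖ := by
  have hv : v = ∑ j : Fin 3, v j • EuclideanSpace.single j (1 : ℝ) := by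
    ext i
    simp [Finset.sum_apply, Pi.single_apply]
  calc ‖fderiv ℝ V x v‖
      = ‖∑ j : Fin 3, v j • fderiv ℝ V x (EuclideanSpace.single j (1 : ℝ))‖ := by
        conv_lhs => rw [hv]
        simp only [map_sum, map_smul]
    _ ≤ ∑ j : Fin 3, ‖fderiv ℝ V x (EuclideanSpace.single j (1 : ℝ))‖ * ‖v j‖ := by
        refine (norm_sum_le _ _).trans (le_of_eq ?_)
        simp only [norm_smul, mul_comm]
    _ ≤ _ := by
        rw [gradNorm, EuclideanSpace.norm_eq]
        exact Real.sum_mul_le_sqrt_mul_sqrt _ _ _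

/-! ### The integral kernel -/

variable {k : ℂ}

theorem norm_exp_I_mul (k : ℂ) (r : ℝ) :
    ‖Complex.exp (Complex.I * k * (r : ℂ))‖ = Real.exp (-(k.im * r)) := by
  rw [Complex.norm_exp]
  congr 1
  simp [mul_assoc]

theorem norm_exp_I_mul_le_one (hk : 0 < k.im) {r : ℝ} (hr : 0 ≤ r) :
    ‖Complex.exp (Complex.I * k * (r : ℂ))‖ ≤ 1 := by
  rw [norm_exp_I_mul]
  exact Real.exp_le_one_iff.2 (by nlinarith)

theorem norm_freeKernel (k : ℂ) (x y : Space) :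
    ‖freeKernel k x y‖ = Real.exp (-(k.im * ‖x - y‖)) / (4 * Real.pi * ‖x - y‖) := by
  rw [freeKernel, norm_div, norm_exp_I_mul]
  simp [abs_of_pos Real.pi_pos]

theorem norm_freeKernel_le (hk : 0 < k.im) (x y : Space) : ‖freeKernel k x y‖ ≤ ‖x - y‖⁻¹ := by
  rw [norm_freeKernel, ← one_div]
  rcases (norm_nonneg (x - y)).eq_or_lt with h | h
  · simp [← h]
  · have h1 : Real.exp (-(k.im * ‖x - y‖)) ≤ 1 := Real.exp_le_one_iff.2 (by nlinarith)
    have h2 : (1 : ℝ) * ‖x - y‖ ≤ 4 * Real.pi * ‖x - y‖ := by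
      gcongr
      linarith [Real.pi_gt_three]
    gcongr
    linarith

theorem measurable_freeKernel (k : ℂ) :
    Measurable fun q : Space × Space => freeKernel k q.1 q.2 := by
  unfold freeKernel
  fun_prop

theorem measurable_freeKernel_right (k : ℂ) (x : Space) : Measurable (freeKernel k x) := by
  unfold freeKernel
  fun_prop

/-- The kernel of the free resolvent is square integrable, thanks to the decay `exp (-r Im k)`. -/
theorem integrable_norm_freeKernel_sq (hk : 0 < k.im) (x : Space) :
    Integrable (fun y => ‖freeKernel k x y‖ ^ 2) := by
  have h : Integrable (fun u : Space =>
      (fun r : ℝ => (Real.exp (-(k.im * r)) / (4 * Real.pi * r)) ^ 2) ‖u‖) := by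
    rw [integrable_fun_norm_addHaar volume
      (f := fun r : ℝ => (Real.exp (-(k.im * r)) / (4 * Real.pi * r)) ^ 2), finrank_space]
    have h1 : IntegrableOn (fun r : ℝ => (1 / (4 * Real.pi)) ^ 2 * Real.exp (-(2 * k.im) * r))
        (Ioi 0) := (exp_neg_integrableOn_Ioi 0 (by linarith)).const_mul _
    refine h1.congr_fun (fun r hr => ?_) measurableSet_Ioi
    have hr0 : r ≠ 0 := (mem_Ioi.1 hr).ne'
    have hexp : Real.exp (-(2 * k.im) * r) = Real.exp (-(k.im * r)) ^ 2 := by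
      rw [← Real.exp_nat_mul]
      congr 1
      push_cast
      ring
    simp only [smul_eq_mul, hexp]
    field_simp
  simpa only [norm_freeKernel] using h.comp_sub_left x

theorem integral_norm_freeKernel_sq (k : ℂ) (x : Space) :
    ∫ y, ‖freeKernel k x y‖ ^ 2 = ∫ y, ‖freeKernel k 0 y‖ ^ 2 := by
  have h1 := integral_sub_left_eq_self
    (fun u : Space => (Real.exp (-(k.im * ‖u‖)) / (4 * Real.pi * ‖u‖)) ^ 2) volume x
  have h2 := integral_sub_left_eq_self
    (fun u : Space => (Real.exp (-(k.im * ‖u‖)) / (4 * Real.pi * ‖u‖)) ^ 2) volume 0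
  simp only [norm_freeKernel]
  rw [h1, h2]

theorem memLp_freeKernel (hk : 0 < k.im) (x : Space) : MemLp (freeKernel k x) 2 :=
  (memLp_two_iff_integrable_sq_norm (measurable_freeKernel_right k x).aestronglyMeasurable).2
    (integrable_norm_freeKernel_sq hk x)

theorem integrable_freeKernel_mul (hk : 0 < k.im) {f : Space → ℂ} (hf : MemLp f 2) (x : Space) :
    Integrable (fun y => freeKernel k x y * f y) :=
  (memLp_freeKernel hk x).integrable_mul hf

/-- The free resolvent maps `L²` to bounded functions. -/
theorem integral_norm_freeKernel_mul_le (hk : 0 < k.im) {f : Space → ℂ} (hf : MemLp f 2)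
    (x : Space) :
    ∫ y, ‖freeKernel k x y * f y‖ ≤ (∫ y, ‖freeKernel k 0 y‖ ^ 2) + ∫ y, ‖f y‖ ^ 2 := by
  have hf2 : Integrable (fun y => ‖f y‖ ^ 2) := (memLp_two_iff_integrable_sq_norm hf.1).1 hf
  rw [← integral_norm_freeKernel_sq k x, ← integral_add (integrable_norm_freeKernel_sq hk x) hf2]
  refine integral_mono (integrable_freeKernel_mul hk hf x).norm
    ((integrable_norm_freeKernel_sq hk x).add hf2) fun y => ?_
  simp only [norm_mul]
  nlinarith [sq_nonneg (‖freeKernel k x y‖ - ‖f y‖), sq_nonneg ‖freeKernel k x y‖,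
    sq_nonneg ‖f y‖]

theorem integrable_freeKernel_mul_potential (hV : Continuous V) (hsupp : HasCompactSupport V)
    (hk : 0 < k.im) (x : Space) : Integrable (fun z => freeKernel k x z * V z) := by
  refine (integrable_norm_div_norm_sub hV hsupp x).mono'
    ((measurable_freeKernel_right k x).mul hV.measurable).aestronglyMeasurable
    (Eventually.of_forall fun z => ?_)
  rw [norm_mul, div_eq_inv_mul]
  gcongr
  exact norm_freeKernel_le hk x z

/-- The integrand of the iterated integral `R₀ V R₀ f`, as a function of both variables. -/
theorem integrable_prod_freeKernel (hV : Continuous V) (hsupp : HasCompactSupport V)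
    (hk : 0 < k.im) {f : Space → ℂ} (hf : MemLp f 2) (x : Space) :
    Integrable (fun q : Space × Space =>
      freeKernel k x q.1 * V q.1 * (freeKernel k q.1 q.2 * f q.2)) (volume.prod volume) := by
  have hmeas : AEStronglyMeasurable (fun q : Space × Space =>
      freeKernel k x q.1 * V q.1 * (freeKernel k q.1 q.2 * f q.2)) (volume.prod volume) := by
    refine ((((measurable_freeKernel_right k x).mul
      hV.measurable).comp measurable_fst).aestronglyMeasurable).mul
      ((measurable_freeKernel k).aestronglyMeasurable.mul ?_)
    exact hf.1.comp_snd
  rw [integrable_prod_iff hmeas]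
  refine ⟨Eventually.of_forall fun z =>
    (integrable_freeKernel_mul hk hf z).const_mul (freeKernel k x z * V z), ?_⟩
  refine ((integrable_freeKernel_mul_potential hV hsupp hk x).norm.mul_const
    ((∫ y, ‖freeKernel k 0 y‖ ^ 2) + ∫ y, ‖f y‖ ^ 2)).mono' hmeas.norm.integral_prod_right'
    (Eventually.of_forall fun z => ?_)
  rw [Real.norm_of_nonneg (integral_nonneg fun _ => norm_nonneg _)]
  simp only [norm_mul (freeKernel k x z * V z)]
  rw [integral_const_mul]
  gcongr
  exact integral_norm_freeKernel_mul_le hk hf z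

theorem norm_sandwichIntegrand_le (hk : 0 < k.im) (V : Space → ℂ) (x y z : Space) :
    ‖sandwichIntegrand k V x y z‖ ≤ ‖V z‖ / (‖x - z‖ * ‖z - y‖) := by
  rw [sandwichIntegrand, norm_mul, norm_div, norm_mul, div_mul_eq_mul_div]
  have h1 := norm_exp_I_mul_le_one hk (norm_nonneg (x - z))
  have h2 := norm_exp_I_mul_le_one hk (norm_nonneg (z - y))
  have h3 : ‖((‖x - z‖ : ℂ) * (‖z - y‖ : ℂ))‖ = ‖x - z‖ * ‖z - y‖ := by simp
  rw [h3]
  gcongr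
  exact mul_le_of_le_one_left (norm_nonneg _) (mul_le_one₀ h1 (norm_nonneg _) h2)

theorem measurable_sandwichIntegrand (hV : Continuous V) (k : ℂ) (x y : Space) :
    Measurable (sandwichIntegrand k V x y) := by
  unfold sandwichIntegrand
  have := hV.measurable
  fun_prop

/-- The arithmetic–geometric mean inequality `1 / (a b) ≤ 1 / a² + 1 / b²` covers also the case
`x = y`, in which the two singularities coincide. -/
theorem integrable_sandwichIntegrand (hV : Continuous V) (hsupp : HasCompactSupport V)
    (hk : 0 < k.im) (x y : Space) : Integrable (sandwichIntegrand k V x y) := by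
  have h (x : Space) := integrable_mul_inv_norm_sub_pow hV.norm hsupp.norm le_rfl x
  refine ((h x).add (h y)).mono' (measurable_sandwichIntegrand hV k x y).aestronglyMeasurable
    (Eventually.of_forall fun z => (norm_sandwichIntegrand_le hk V x y z).trans ?_)
  rw [div_eq_mul_inv, mul_inv, Pi.add_apply, ← mul_add, norm_sub_rev y z]
  gcongr
  nlinarith [sq_nonneg (‖x - z‖⁻¹ - ‖z - y‖⁻¹), sq_nonneg ‖x - z‖⁻¹, sq_nonneg ‖z - y‖⁻¹]

theorem sandwichKernel_eq_integral (k : ℂ) (V : Space → ℂ) (x y : Space) :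
    sandwichKernel k V x y = ∫ z, freeKernel k x z * V z * freeKernel k z y := by
  rw [sandwichKernel, ← integral_const_mul]
  congr 1
  ext z
  simp only [sandwichIntegrand, freeKernel, div_eq_mul_inv, mul_inv]
  norm_num
  ring

theorem sandwichKernel_mul_eq_integral (k : ℂ) (V f : Space → ℂ) (x y : Space) :
    sandwichKernel k V x y * f y =
      ∫ z, freeKernel k x z * V z * (freeKernel k z y * f y) := by
  rw [sandwichKernel_eq_integral, ← integral_mul_const]
  simp only [mul_assoc]

theorem freeKernel_mul_freeResolvent (k : ℂ) (V f : Space → ℂ) (x z : Space) :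
    freeKernel k x z * (V z * freeResolvent k f z) =
      ∫ y, freeKernel k x z * V z * (freeKernel k z y * f y) := by
  rw [integral_const_mul, freeResolvent, mul_assoc]

/-- By Fubini's theorem `G_λ` is the integral kernel of `R₀ V R₀` on `L²`. -/
theorem sandwichKernel_spec (hV : Continuous V) (hsupp : HasCompactSupport V)
    (hk : 0 < k.im) {f : Space → ℂ} (hf : MemLp f 2) (x : Space) :
    Integrable (fun z => freeKernel k x z * (V z * freeResolvent k f z)) ∧
    Integrable (fun y => sandwichKernel k V x y * f y) ∧
    freeResolvent k (fun z => V z * freeResolvent k f z) x = ∫ y, sandwichKernel k V x y * f y := by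
  have h := integrable_prod_freeKernel hV hsupp hk hf x
  simp only [sandwichKernel_mul_eq_integral, freeKernel_mul_freeResolvent]
  refine ⟨h.integral_prod_left, h.integral_prod_right, ?_⟩
  rw [freeResolvent]
  simp only [freeKernel_mul_freeResolvent]
  exact integral_integral_swap h

/-- The estimate without oscillation: `1 / (a b) ≤ (1 / a + 1 / b) / d` if `d ≤ a + b`. -/
theorem norm_integral_sandwichIntegrand_le_newtonPotential (hV : Continuous V)
    (hsupp : HasCompactSupport V) (hk : 0 < k.im) {x y : Space} (hxy : x ≠ y) :
    ‖∫ z, sandwichIntegrand k V x y z‖ ≤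
      (newtonPotential V x + newtonPotential V y) / ‖x - y‖ := by
  have hd : 0 < ‖x - y‖ := norm_pos_iff.2 (sub_ne_zero.2 hxy)
  have hint := integrable_norm_div_norm_sub hV hsupp
  rw [newtonPotential, newtonPotential, ← integral_add (hint x) (hint y), ← integral_div]
  refine norm_integral_le_of_norm_le (((hint x).add (hint y)).div_const _)
    (Eventually.of_forall fun z => (norm_sandwichIntegrand_le hk V x y z).trans ?_)
  rw [norm_sub_rev y z]
  -- At `z = x` and `z = y` the left-hand side is `0`, as a quotient by zero.
  rcases (norm_nonneg (x - z)).eq_or_lt with ha | ha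
  · rw [← ha]
    simp only [zero_mul, div_zero]
    positivity
  rcases (norm_nonneg (z - y)).eq_or_lt with hb | hb
  · rw [← hb]
    simp only [mul_zero, div_zero]
    positivity
  have htri : ‖x - y‖ ≤ ‖x - z‖ + ‖z - y‖ := norm_sub_le_norm_sub_add_norm_sub x z y
  rw [div_add_div _ _ ha.ne' hb.ne', div_div, div_le_div_iff₀ (by positivity) (by positivity)]
  have : 0 ≤ ‖V z‖ * (‖x - z‖ * ‖z - y‖) := by positivity
  nlinarith

/-! ### Prolate spheroidal coordinates -/

/-- The distance sum `s = |x - z| + |z - y|` as a function of the radial parameter `p`. -/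
noncomputable def focalSum (x y : Space) (p : ℝ) : ℝ := Real.sqrt (p ^ 2 + ‖x - y‖ ^ 2)

/-- Prolate spheroidal coordinates with foci `x` and `y`, without a choice of axes. If `p = |u|` and
`s = focalSum x y p`, then `u` is sent to the point with `|x - z| + |z - y| = s` and
`|z - y| - |x - z| = ⟪x - y, u⟫ / p`, and the azimuth about the axis through the foci is kept. The
map is used only for `u ≠ 0`. -/
noncomputable def spheroidalMap (x y u : Space) : Space :=
  (1 / 2 : ℝ) • (x + y + u + (1 / (‖u‖ * (‖u‖ + focalSum x y ‖u‖)) * ⟪x - y, u⟫) • (x - y))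

theorem focalSum_comm (x y : Space) (p : ℝ) : focalSum x y p = focalSum y x p := by
  rw [focalSum, focalSum, norm_sub_rev]

theorem focalSum_sq (x y : Space) (p : ℝ) : focalSum x y p ^ 2 = p ^ 2 + ‖x - y‖ ^ 2 :=
  Real.sq_sqrt (by positivity)

theorem focalSum_nonneg (x y : Space) (p : ℝ) : 0 ≤ focalSum x y p := Real.sqrt_nonneg _

theorem focalSum_pos (x y : Space) {p : ℝ} (hp : 0 < p) : 0 < focalSum x y p :=
  Real.sqrt_pos.2 (by positivity)

theorem le_focalSum (x y : Space) (p : ℝ) : p ≤ focalSum x y p :=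
  Real.le_sqrt_of_sq_le (by nlinarith [sq_nonneg ‖x - y‖])

theorem norm_sub_lt_focalSum (x y : Space) {p : ℝ} (hp : 0 < p) : ‖x - y‖ < focalSum x y p :=
  Real.lt_sqrt_of_sq_lt (by nlinarith)

theorem focalSum_le (x y : Space) {p : ℝ} (hp : 0 ≤ p) : focalSum x y p ≤ p + ‖x - y‖ :=
  Real.sqrt_le_iff.2 ⟨by positivity, by nlinarith [mul_nonneg hp (norm_nonneg (x - y))]⟩

theorem spheroidalMap_comm (x y u : Space) : spheroidalMap x y u = spheroidalMap y x u := by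
  rw [spheroidalMap, spheroidalMap, focalSum_comm x y, ← neg_sub y x, inner_neg_left, add_comm x y]
  module

theorem abs_inner_div_norm_le (w u : Space) : |⟪w, u⟫ / ‖u‖| ≤ ‖w‖ := by
  rw [abs_div, abs_norm]
  exact div_le_of_le_mul₀ (norm_nonneg _) (norm_nonneg _) (abs_real_inner_le_norm w u)

theorem norm_sub_spheroidalMap (x y : Space) {u : Space} (hu : u ≠ 0) :
    ‖x - spheroidalMap x y u‖ = (focalSum x y ‖u‖ - ⟪x - y, u⟫ / ‖u‖) / 2 := by
  have hp : 0 < ‖u‖ := norm_pos_iff.2 hu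
  have hs := focalSum_pos x y hp
  have hs2 := focalSum_sq x y ‖u‖
  have hτ := abs_inner_div_norm_le (x - y) u
  have hd := norm_sub_lt_focalSum x y hp
  set w := x - y with hw
  set s := focalSum x y ‖u‖
  set p := ‖u‖ with hpu
  set τ := ⟪w, u⟫ with hτdef
  have hx : x - spheroidalMap x y u =
      (1 / 2 : ℝ) • ((1 - 1 / (p * (p + s)) * τ) • w - u) := by
    rw [spheroidalMap]
    generalize 1 / (p * (p + s)) * τ = c
    rw [hw]
    module
  have hpos : 0 ≤ (s - τ / p) / 2 := by linarith [le_abs_self (τ / p)]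
  rw [← sq_eq_sq₀ (norm_nonneg _) hpos, hx, norm_smul, mul_pow, norm_sub_sq_real, norm_smul,
    inner_smul_left, ← hτdef, ← hpu, mul_pow]
  have hdw : ‖w‖ ^ 2 = s ^ 2 - p ^ 2 := by linarith
  rw [hdw]
  simp only [Real.norm_eq_abs, sq_abs]
  simp
  field_simp
  ring

theorem norm_spheroidalMap_sub (x y : Space) {u : Space} (hu : u ≠ 0) :
    ‖spheroidalMap x y u - y‖ = (focalSum x y ‖u‖ + ⟪x - y, u⟫ / ‖u‖) / 2 := by
  rw [norm_sub_rev, spheroidalMap_comm, norm_sub_spheroidalMap y x hu, focalSum_comm y x,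
    ← neg_sub x y, inner_neg_left]
  ring

theorem norm_sub_add_norm_sub_spheroidalMap (x y : Space) {u : Space} (hu : u ≠ 0) :
    ‖x - spheroidalMap x y u‖ + ‖spheroidalMap x y u - y‖ = focalSum x y ‖u‖ := by
  rw [norm_sub_spheroidalMap x y hu, norm_spheroidalMap_sub x y hu]
  ring

theorem norm_sub_spheroidalMap_pos (x y : Space) {u : Space} (hu : u ≠ 0) :
    0 < ‖x - spheroidalMap x y u‖ := by
  rw [norm_sub_spheroidalMap x y hu]
  have := norm_sub_lt_focalSum x y (norm_pos_iff.2 hu)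
  linarith [(le_abs_self _).trans (abs_inner_div_norm_le (x - y) u)]

theorem norm_spheroidalMap_sub_pos (x y : Space) {u : Space} (hu : u ≠ 0) :
    0 < ‖spheroidalMap x y u - y‖ := by
  rw [norm_sub_rev, spheroidalMap_comm]
  exact norm_sub_spheroidalMap_pos y x hu

/-- The focal distances of the image determine `‖u‖` and `⟪x - y, u⟫`, hence the stretching term,
and then `u` itself. -/
theorem injOn_spheroidalMap (x y : Space) : InjOn (spheroidalMap x y) {0}ᶜ := by
  intro u hu v hv huv
  have hu : u ≠ 0 := hu
  have hv : v ≠ 0 := hv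
  have h1 := norm_sub_spheroidalMap x y hu
  have h2 := norm_spheroidalMap_sub x y hu
  have h3 := norm_sub_spheroidalMap x y hv
  have h4 := norm_spheroidalMap_sub x y hv
  rw [huv] at h1 h2
  have hs : focalSum x y ‖u‖ = focalSum x y ‖v‖ := by linarith
  have hn : ‖u‖ = ‖v‖ := by
    have hu2 := focalSum_sq x y ‖u‖
    have hv2 := focalSum_sq x y ‖v‖
    rw [hs] at hu2
    exact (sq_eq_sq₀ (norm_nonneg _) (norm_nonneg _)).1 (by linarith)
  have hi : ⟪x - y, u⟫ = ⟪x - y, v⟫ := by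
    have h : ⟪x - y, u⟫ / ‖u‖ = ⟪x - y, v⟫ / ‖v‖ := by linarith
    rw [hn] at h
    exact (div_left_inj' (norm_pos_iff.2 hv).ne').1 h
  rw [spheroidalMap, spheroidalMap, hn, hi] at huv
  have h := smul_right_injective Space (by norm_num : (1 / 2 : ℝ) ≠ 0) huv
  exact add_left_cancel (add_right_cancel h)

/-- The preimage is found by solving for `‖u‖ = p` and `⟪x - y, u⟫ = p δ`, where `s` is the sum and
`δ` the difference of the focal distances of `z`. -/
theorem mem_image_spheroidalMap {x y z : Space} (hz : ‖x - y‖ < ‖x - z‖ + ‖z - y‖) :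
    z ∈ spheroidalMap x y '' {0}ᶜ := by
  set w := x - y with hw
  set s := ‖x - z‖ + ‖z - y‖ with hs
  set δ := ‖z - y‖ - ‖x - z‖ with hδ
  set p := Real.sqrt (s ^ 2 - ‖w‖ ^ 2) with hp
  have hs0 : 0 < s := (norm_nonneg _).trans_lt hz
  have hsw : 0 < s ^ 2 - ‖w‖ ^ 2 := by nlinarith [norm_nonneg w]
  have hp0 : 0 < p := Real.sqrt_pos.2 hsw
  have hp2 : p ^ 2 = s ^ 2 - ‖w‖ ^ 2 := Real.sq_sqrt hsw.le
  set q := (2 : ℝ) • z - x - y with hq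
  have ha : 4 * ‖x - z‖ ^ 2 = ‖w‖ ^ 2 - 2 * ⟪w, q⟫ + ‖q‖ ^ 2 := by
    rw [← norm_sub_sq_real, show w - q = (2 : ℝ) • (x - z) by rw [hw, hq]; module, norm_smul]
    norm_num
    ring
  have hb : 4 * ‖z - y‖ ^ 2 = ‖w‖ ^ 2 + 2 * ⟪w, q⟫ + ‖q‖ ^ 2 := by
    rw [← norm_add_sq_real, show w + q = (2 : ℝ) • (z - y) by rw [hw, hq]; module, norm_smul]
    norm_num
    ring
  have hwq : ⟪w, q⟫ = s * δ := by rw [hs, hδ]; linarith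
  have hqq : ‖q‖ ^ 2 = s ^ 2 + δ ^ 2 - ‖w‖ ^ 2 := by rw [hs, hδ]; linarith
  set u := q - (δ / (p + s)) • w with hu
  have hww : ‖w‖ ^ 2 = s ^ 2 - p ^ 2 := by linarith
  have hnorm : ‖u‖ = p := by
    rw [← sq_eq_sq₀ (norm_nonneg _) hp0.le, hu, norm_sub_sq_real, inner_smul_right, norm_smul,
      real_inner_comm, hwq, hqq, mul_pow, Real.norm_eq_abs, sq_abs, hww]
    field_simp
    ring
  have hinner : ⟪w, u⟫ = p * δ := by
    rw [hu, inner_sub_right, inner_smul_right, real_inner_self_eq_norm_sq, hwq, hww]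
    field_simp
    ring
  refine ⟨u, fun h => ?_, ?_⟩
  · rw [h, norm_zero] at hnorm
    exact hp0.ne hnorm
  · have hfs : focalSum x y p = s := by
      rw [focalSum, ← hw, hp2, sub_add_cancel, Real.sqrt_sq hs0.le]
    rw [spheroidalMap, hnorm, hfs, ← hw, hinner,
      show 1 / (p * (p + s)) * (p * δ) = δ / (p + s) by field_simp, hu, hq]
    module

/-- The coordinates miss only the segment between the foci. -/
theorem compl_image_spheroidalMap_null (x y : Space) :
    volume (spheroidalMap x y '' {0}ᶜ)ᶜ = 0 := by
  refine measure_mono_null (t := (affineSpan ℝ {x, y} : Set Space)) (fun z hz => ?_) ?_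
  · have hz' : dist x z + dist z y = dist x y := by
      refine le_antisymm (not_lt.1 fun h => hz (mem_image_spheroidalMap ?_)) (dist_triangle x z y)
      simpa [dist_eq_norm] using h
    exact (dist_add_dist_eq_iff.1 hz').mem_affineSpan
  · refine Measure.addHaar_affineSubspace _ _ fun h => ?_
    have h1 := finrank_vectorSpan_insert_le_set ℝ {y} x
    have h2 : vectorSpan ℝ ({x, y} : Set Space) = ⊤ := by
      rw [← direction_affineSpan, h, AffineSubspace.direction_top]
    rw [h2, finrank_top, finrank_space, vectorSpan_singleton, finrank_bot] at h1
    omega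

theorem hasDerivAt_focalSum (x y : Space) {p : ℝ} (hp : 0 < p) :
    HasDerivAt (focalSum x y) (p / focalSum x y p) p := by
  have h := ((hasDerivAt_pow 2 p).add_const (‖x - y‖ ^ 2)).sqrt (by positivity)
  refine h.congr_deriv ?_
  rw [focalSum]
  field_simp
  simp

/-- The radial factor `1 / (p (p + s))` of the stretching has derivative `-1 / (s p²)`. -/
theorem hasDerivAt_stretch (x y : Space) {p : ℝ} (hp : 0 < p) :
    HasDerivAt (fun p => 1 / (p * (p + focalSum x y p))) (-(1 / (focalSum x y p * p ^ 2))) p := by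
  have hs := focalSum_pos x y hp
  have hd := hasDerivAt_focalSum x y hp
  have h := ((hasDerivAt_id p).mul ((hasDerivAt_id p).add hd)).inv
    (by simp only [id, Pi.mul_apply, Pi.add_apply]; positivity)
  simp only [one_div]
  refine h.congr_deriv ?_
  simp only [id, Pi.mul_apply, Pi.add_apply]
  field_simp
  ring

/-- The differential of the coefficient of `x - y` in the stretching term of `spheroidalMap`. -/
noncomputable def stretchDeriv (x y u : Space) : Space →L[ℝ] ℝ :=
  (1 / (‖u‖ * (‖u‖ + focalSum x y ‖u‖))) • innerSL ℝ (x - y) +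
    (-(⟪x - y, u⟫ / (focalSum x y ‖u‖ * ‖u‖ ^ 3))) • innerSL ℝ u

/-- The differential of `spheroidalMap`. -/
noncomputable def spheroidalDeriv (x y u : Space) : Space →L[ℝ] Space :=
  (1 / 2 : ℝ) • (ContinuousLinearMap.id ℝ Space + (stretchDeriv x y u).smulRight (x - y))

theorem hasFDerivAt_spheroidalMap (x y : Space) {u : Space} (hu : u ≠ 0) :
    HasFDerivAt (spheroidalMap x y) (spheroidalDeriv x y u) u := by
  have hp : 0 < ‖u‖ := norm_pos_iff.2 hu
  have hs := focalSum_pos x y hp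
  have hnorm : HasFDerivAt (fun v : Space => ‖v‖) ((1 / ‖u‖) • innerSL ℝ u) u := by
    have h := (hasStrictFDerivAt_norm_sq u).hasFDerivAt.sqrt (by positivity)
    simp only [Real.sqrt_sq (norm_nonneg _)] at h
    refine h.congr_fderiv ?_
    ext v
    simp
    field_simp
  have hc := (hasDerivAt_stretch x y hp).comp_hasFDerivAt u hnorm
  have hi : HasFDerivAt (fun v => ⟪x - y, v⟫) (innerSL ℝ (x - y)) u :=
    (innerSL ℝ (x - y)).hasFDerivAt
  have hmul := (hc.mul hi).smul_const (x - y)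
  have h := (((hasFDerivAt_id u).const_add (x + y)).add hmul).const_smul (1 / 2 : ℝ)
  refine h.congr_fderiv ?_
  rw [spheroidalDeriv]
  congr 2
  ext1 v
  rw [stretchDeriv]
  simp only [ContinuousLinearMap.smulRight_apply, add_apply,
    smul_apply, smul_eq_mul, innerSL_apply_apply, Function.comp]
  field_simp

/-- The Jacobian of the coordinates, by the determinant formula for a rank-one perturbation of the
identity. -/
theorem det_spheroidalDeriv (x y : Space) {u : Space} (hu : u ≠ 0) :
    (spheroidalDeriv x y u).det =
      ‖x - spheroidalMap x y u‖ * ‖spheroidalMap x y u - y‖ / (2 * ‖u‖ * focalSum x y ‖u‖) := by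
  have hp : 0 < ‖u‖ := norm_pos_iff.2 hu
  have hs := focalSum_pos x y hp
  have hs2 : ‖x - y‖ ^ 2 = focalSum x y ‖u‖ ^ 2 - ‖u‖ ^ 2 := by
    rw [focalSum_sq]
    ring
  have h : ((spheroidalDeriv x y u : Space →L[ℝ] Space) : Space →ₗ[ℝ] Space) =
      (1 / 2 : ℝ) • LinearMap.transvection (stretchDeriv x y u : Space →ₗ[ℝ] ℝ) (x - y) := by
    ext1 v
    simp [spheroidalDeriv, LinearMap.transvection]
  rw [ContinuousLinearMap.det, h, LinearMap.det_smul, LinearMap.transvection.det, finrank_space,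
    norm_sub_spheroidalMap x y hu, norm_spheroidalMap_sub x y hu]
  simp only [stretchDeriv, ContinuousLinearMap.coe_coe, add_apply,
    smul_apply, smul_eq_mul, innerSL_apply_apply, real_inner_self_eq_norm_sq,
    real_inner_comm (x - y) u, hs2]
  field_simp
  ring

/-- The change of variables, with the Jacobian `a b / (2 p s)`. -/
theorem integral_eq_integral_spheroidalMap (x y : Space) (g : Space → ℂ) :
    ∫ z, g z = ∫ u, (‖x - spheroidalMap x y u‖ * ‖spheroidalMap x y u - y‖ /
      (2 * ‖u‖ * focalSum x y ‖u‖)) • g (spheroidalMap x y u) := by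
  have hm : MeasurableSet ({0}ᶜ : Set Space) := (measurableSet_singleton 0).compl
  calc ∫ z, g z = ∫ z in spheroidalMap x y '' {0}ᶜ, g z := by
        rw [← setIntegral_univ]
        refine (setIntegral_congr_set ?_).symm
        rw [ae_eq_univ]
        exact compl_image_spheroidalMap_null x y
    _ = ∫ u in ({0}ᶜ : Set Space), |(spheroidalDeriv x y u).det| • g (spheroidalMap x y u) :=
        integral_image_eq_integral_abs_det_fderiv_smul _ hm
          (fun u hu => (hasFDerivAt_spheroidalMap x y hu).hasFDerivWithinAt)
          (injOn_spheroidalMap x y) g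
    _ = _ := by
        conv_rhs => rw [← restrict_compl_singleton (μ := (volume : Measure Space)) 0]
        refine setIntegral_congr_fun hm fun u hu => ?_
        rw [det_spheroidalDeriv x y hu, abs_of_nonneg]
        have := focalSum_nonneg x y ‖u‖
        positivity

/-- A bound for a volume integral in `ℝ³` by bounds for the integrals along the rays; no
integrability is needed because the integral of a function that is not integrable is `0`. -/
theorem norm_integral_le_of_norm_integral_ray_le {h : Space → ℂ} {B : ℝ}
    (hB : ∀ ω : Space, ‖ω‖ = 1 → ‖∫ r in Ioi (0 : ℝ), (r ^ 2) • h (r • ω)‖ ≤ B) :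
    ‖∫ u, h u‖ ≤ 4 * Real.pi * B := by
  have hB0 : 0 ≤ B := (norm_nonneg _).trans (hB (EuclideanSpace.single 0 1) (by simp))
  have hsphere : (volume : Measure Space).toSphere.real univ = 4 * Real.pi := by
    rw [Measure.toSphere_real_apply_univ, finrank_space, measureReal_def,
      EuclideanSpace.volume_ball_fin_three]
    rw [ENNReal.ofReal_one, one_pow, one_mul, ENNReal.toReal_ofReal (by positivity)]
    push_cast
    ring
  have hpolar : ∫ u, h u = ∫ q : sphere (0 : Space) 1 × Ioi (0 : ℝ), h (q.2.1 • q.1.1)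
      ∂((volume : Measure Space).toSphere.prod (Measure.volumeIoiPow 2)) := by
    have hmp := (volume : Measure Space).measurePreserving_homeomorphUnitSphereProd
    rw [finrank_space] at hmp
    conv_lhs => rw [← restrict_compl_singleton (μ := (volume : Measure Space)) 0,
      ← integral_subtype_comap (measurableSet_singleton _).compl]
    rw [← hmp.integral_comp (Homeomorph.measurableEmbedding _)]
    congr 1
    ext u
    congr 1
    have hu : ‖(u : Space)‖ ≠ 0 := norm_ne_zero_iff.2 u.2
    simp [smul_smul, hu]
  have hray (ω : sphere (0 : Space) 1) :
      ∫ r : Ioi (0 : ℝ), h (r.1 • ω.1) ∂(Measure.volumeIoiPow 2) =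
        ∫ r in Ioi (0 : ℝ), (r ^ 2) • h (r • ω.1) := by
    simp only [Measure.volumeIoiPow, ENNReal.ofReal]
    rw [integral_withDensity_eq_integral_smul,
      integral_subtype_comap measurableSet_Ioi
        fun a : ℝ => Real.toNNReal (a ^ 2) • h (a • ω.1)]
    · refine setIntegral_congr_fun measurableSet_Ioi fun r _ => ?_
      rw [NNReal.smul_def, Real.coe_toNNReal _ (sq_nonneg r)]
    · exact (measurable_subtype_coe.pow_const _).real_toNNReal
  rw [hpolar]
  by_cases hint : Integrable (fun q : sphere (0 : Space) 1 × Ioi (0 : ℝ) => h (q.2.1 • q.1.1))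
      ((volume : Measure Space).toSphere.prod (Measure.volumeIoiPow 2))
  · rw [integral_prod _ hint]
    simp only [hray]
    refine (norm_integral_le_of_norm_le_const (C := B)
      (Eventually.of_forall fun ω : sphere (0 : Space) 1 => hB ω.1 (by simp))).trans_eq ?_
    rw [hsphere, mul_comm]
  · rw [integral_undef hint, norm_zero]
    positivity

/-! ### The oscillatory estimate -/

theorem continuous_focalSum (x y : Space) : Continuous (focalSum x y) := by
  unfold focalSum
  fun_prop

/-- The coordinate line of `spheroidalMap` in the direction of the unit vector `ω`. It is a branch
of a hyperbola with foci `x` and `y`, and it starts on the segment between them. The factor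
`(s - p) / |x - y|²` equals `1 / (s + p)`; this form is continuous in `p` even if `x = y`, where
it is `0` but multiplies the vector `x - y = 0`. -/
noncomputable def hyperbola (x y ω : Space) (p : ℝ) : Space :=
  (1 / 2 : ℝ) • (x + y + p • ω + (⟪x - y, ω⟫ * ((focalSum x y p - p) / ‖x - y‖ ^ 2)) • (x - y))

/-- The velocity of `hyperbola`. -/
noncomputable def hyperbolaVelocity (x y ω : Space) (p : ℝ) : Space :=
  (1 / 2 : ℝ) • (ω + (⟪x - y, ω⟫ * ((p / focalSum x y p - 1) / ‖x - y‖ ^ 2)) • (x - y))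

theorem spheroidalMap_smul (x y : Space) {ω : Space} (hω : ‖ω‖ = 1) {p : ℝ} (hp : 0 < p) :
    spheroidalMap x y (p • ω) = hyperbola x y ω p := by
  have hn : ‖p • ω‖ = p := by rw [norm_smul, hω, mul_one, Real.norm_of_nonneg hp.le]
  rw [spheroidalMap, hyperbola, hn]
  rcases eq_or_ne (x - y) 0 with h | h
  · simp [h]
  · have hs := focalSum_pos x y hp
    have hd : ‖x - y‖ ≠ 0 := norm_ne_zero_iff.2 h
    congr 3
    rw [inner_smul_right]
    field_simp
    linear_combination -(⟪x - y, ω⟫ * focalSum_sq x y p)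

theorem continuous_hyperbola (x y ω : Space) : Continuous (hyperbola x y ω) := by
  have := continuous_focalSum x y
  unfold hyperbola
  fun_prop

theorem hasDerivAt_hyperbola (x y ω : Space) {p : ℝ} (hp : 0 < p) :
    HasDerivAt (hyperbola x y ω) (hyperbolaVelocity x y ω p) p := by
  have h1 := ((((hasDerivAt_focalSum x y hp).sub (hasDerivAt_id p)).div_const
    (‖x - y‖ ^ 2)).const_mul ⟪x - y, ω⟫).smul_const (x - y)
  have h2 := ((hasDerivAt_id p).smul_const ω).const_add (x + y)
  refine ((h2.add h1).const_smul (1 / 2 : ℝ)).congr_deriv ?_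
  rw [hyperbolaVelocity, one_smul]

theorem continuousOn_hyperbolaVelocity (x y ω : Space) :
    ContinuousOn (hyperbolaVelocity x y ω) (Ioi 0) := by
  have h := (continuous_focalSum x y).continuousOn (s := Ioi 0)
  have h0 : ∀ p ∈ Ioi (0 : ℝ), focalSum x y p ≠ 0 := fun p hp => (focalSum_pos x y hp).ne'
  unfold hyperbolaVelocity
  fun_prop (disch := assumption)

/-- In the parameter `p` the coordinate lines are traversed with speed at most `1 / 2`. -/
theorem norm_hyperbolaVelocity_le (x y : Space) {ω : Space} (hω : ‖ω‖ = 1) {p : ℝ} (hp : 0 < p) :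
    ‖hyperbolaVelocity x y ω p‖ ≤ 1 / 2 := by
  have hs := focalSum_pos x y hp
  set κ := (1 - p / focalSum x y p) / ‖x - y‖ ^ 2 with hκ
  have h1 : p / focalSum x y p ≤ 1 := div_le_one_of_le₀ (le_focalSum x y p) hs.le
  have h0 : 0 ≤ p / focalSum x y p := by positivity
  have hκ0 : 0 ≤ κ := div_nonneg (by linarith) (by positivity)
  have hκ1 : κ * ‖x - y‖ ^ 2 ≤ 1 := by
    rcases eq_or_ne ‖x - y‖ 0 with h | h
    · simp [h]
    · rw [hκ, div_mul_cancel₀ _ (pow_ne_zero 2 h)]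
      linarith
  have hv : hyperbolaVelocity x y ω p = (1 / 2 : ℝ) • (ω - (⟪x - y, ω⟫ * κ) • (x - y)) := by
    rw [hyperbolaVelocity, hκ]
    module
  have hle : ‖ω - (⟪x - y, ω⟫ * κ) • (x - y)‖ ^ 2 ≤ 1 ^ 2 := by
    rw [norm_sub_sq_real, hω, inner_smul_right, norm_smul, real_inner_comm (x - y) ω,
      mul_pow,
      Real.norm_eq_abs, sq_abs]
    have : 0 ≤ κ * ⟪x - y, ω⟫ ^ 2 * (2 - κ * ‖x - y‖ ^ 2) := by
      have : 0 ≤ 2 - κ * ‖x - y‖ ^ 2 := by linarith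
      positivity
    linarith
  rw [hv, norm_smul]
  have := (sq_le_sq₀ (norm_nonneg _) zero_le_one).1 hle
  norm_num
  linarith

theorem norm_add_norm_hyperbola (x y : Space) {ω : Space} (hω : ‖ω‖ = 1) {p : ℝ} (hp : 0 < p) :
    ‖x - hyperbola x y ω p‖ + ‖hyperbola x y ω p - y‖ = focalSum x y p := by
  have hω0 : ω ≠ 0 := norm_ne_zero_iff.1 (by simp [hω])
  have h := norm_sub_add_norm_sub_spheroidalMap x y (smul_ne_zero hp.ne' hω0)
  rwa [spheroidalMap_smul x y hω hp, norm_smul, hω, mul_one, Real.norm_of_nonneg hp.le] at h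

/-- The parameters at which a coordinate line meets the support of `V`. -/
noncomputable def supportParams (V : Space → ℂ) (x y ω : Space) : Set ℝ :=
  Ioi 0 ∩ hyperbola x y ω ⁻¹' tsupport V

theorem measurableSet_supportParams (V : Space → ℂ) (x y ω : Space) :
    MeasurableSet (supportParams V x y ω) :=
  measurableSet_Ioi.inter
    ((isClosed_tsupport V).preimage (continuous_hyperbola x y ω)).measurableSet

/-- The distance sum varies by at most `2 diam (supp V)` on the support, and it differs from the
parameter by at most `|x - y|`. -/
theorem dist_le_of_mem_supportParams (hsupp : HasCompactSupport V) (x y : Space) {ω : Space}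
    (hω : ‖ω‖ = 1) {p q : ℝ} (hp : p ∈ supportParams V x y ω) (hq : q ∈ supportParams V x y ω) :
    dist p q ≤ 2 * diam (tsupport V) + ‖x - y‖ := by
  wlog hpq : q ≤ p generalizing p q
  · rw [dist_comm]
    exact this hq hp (not_le.1 hpq).le
  have hD : ‖hyperbola x y ω p - hyperbola x y ω q‖ ≤ diam (tsupport V) := by
    rw [← dist_eq_norm]
    exact dist_le_diam_of_mem hsupp.isCompact.isBounded hp.2 hq.2
  have h1 := norm_add_norm_hyperbola x y hω hp.1
  have h2 := norm_add_norm_hyperbola x y hω hq.1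
  have h3 := norm_sub_le_norm_sub_add_norm_sub x (hyperbola x y ω q) (hyperbola x y ω p)
  have h4 := norm_sub_le_norm_sub_add_norm_sub (hyperbola x y ω p) (hyperbola x y ω q) y
  rw [norm_sub_rev (hyperbola x y ω q)] at h3
  rw [Real.dist_eq, abs_of_nonneg (sub_nonneg.2 hpq)]
  linarith [le_focalSum x y p, focalSum_le x y (le_of_lt (mem_Ioi.1 hq.1))]

theorem volume_supportParams_le (hsupp : HasCompactSupport V) (x y : Space) {ω : Space}
    (hω : ‖ω‖ = 1) :
    volume (supportParams V x y ω) ≤ ENNReal.ofReal (2 * diam (tsupport V) + ‖x - y‖) := by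
  refine (Real.volume_le_diam _).trans (ediam_le fun p hp q hq => ?_)
  rw [edist_dist]
  exact ENNReal.ofReal_le_ofReal (dist_le_of_mem_supportParams hsupp x y hω hp hq)

/-- A bounded function of the parameter that vanishes where the coordinate line is outside the
support of `V` is integrable, with the integral bounded by the length of the parameter set. -/
theorem integrableOn_and_norm_integral_le_of_supportParams (hsupp : HasCompactSupport V)
    (x y : Space) {ω : Space} (hω : ‖ω‖ = 1) {g : ℝ → ℂ} (hg : ContinuousOn g (Ioi 0)) {B : ℝ}
    (hB0 : 0 ≤ B) (hB : ∀ p, 0 < p → ‖g p‖ ≤ B)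
    (hzero : ∀ p, 0 < p → hyperbola x y ω p ∉ tsupport V → g p = 0) :
    IntegrableOn g (Ioi 0) ∧
      ‖∫ p in Ioi 0, g p‖ ≤ B * (2 * diam (tsupport V) + ‖x - y‖) := by
  have hsub : supportParams V x y ω ⊆ Ioi 0 := inter_subset_left
  have hvol := volume_supportParams_le hsupp x y hω
  have hfin : volume (supportParams V x y ω) < ⊤ := hvol.trans_lt ENNReal.ofReal_lt_top
  have hz : ∀ p ∈ Ioi 0 \ supportParams V x y ω, g p = 0 := fun p hp =>
    hzero p hp.1 fun h => hp.2 ⟨hp.1, h⟩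
  have hm := measurableSet_supportParams V x y ω
  constructor
  · refine IntegrableOn.of_forall_sdiff_eq_zero (s := supportParams V x y ω) ?_ measurableSet_Ioi hz
    exact IntegrableOn.of_bound hfin ((hg.mono hsub).aestronglyMeasurable hm) B
      ((ae_restrict_mem hm).mono fun p hp => hB p hp.1)
  · rw [setIntegral_eq_of_subset_of_forall_sdiff_eq_zero measurableSet_Ioi hsub hz]
    refine (norm_setIntegral_le_of_norm_le_const hfin fun p hp => hB p hp.1).trans ?_
    gcongr
    exact ENNReal.toReal_le_of_le_ofReal (by positivity) hvol

/-- Integration by parts against the phase `exp (i k s)` along a coordinate line. -/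
theorem norm_integral_hyperbola_le (hV : ContDiff ℝ 1 V) (hsupp : HasCompactSupport V)
    (hk : 0 < k.im) (x y : Space) {ω : Space} (hω : ‖ω‖ = 1) :
    ‖∫ p in Ioi (0 : ℝ), ((p / focalSum x y p : ℝ) : ℂ) *
        Complex.exp (Complex.I * k * (focalSum x y p : ℂ)) * V (hyperbola x y ω p)‖ ≤
      ((⨆ z, ‖V z‖) + (⨆ z, gradNorm V z) / 2 * (2 * diam (tsupport V) + ‖x - y‖)) / ‖k‖ := by
  have hk0 : k ≠ 0 := by
    rintro rfl
    simp at hk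
  have hbV := bddAbove_range_norm hV.continuous hsupp
  have hbG := bddAbove_range_gradNorm hV hsupp
  have hV0 : 0 ≤ ⨆ z, ‖V z‖ := Real.iSup_nonneg fun _ => norm_nonneg _
  have hG0 : 0 ≤ ⨆ z, gradNorm V z := Real.iSup_nonneg fun _ => gradNorm_nonneg V _
  set E : ℝ → ℂ := fun p => Complex.exp (Complex.I * k * (focalSum x y p : ℂ)) with hE
  have hEc : Continuous E := by
    have := continuous_focalSum x y
    fun_prop
  have hE1 (p : ℝ) : ‖E p‖ ≤ 1 := norm_exp_I_mul_le_one hk (focalSum_nonneg x y p)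
  have hγ := continuous_hyperbola x y ω
  set g₁ : ℝ → ℂ := fun p => ((p / focalSum x y p : ℝ) : ℂ) * E p * V (hyperbola x y ω p) with hg₁
  set g₂ : ℝ → ℂ := fun p =>
    E p * fderiv ℝ V (hyperbola x y ω p) (hyperbolaVelocity x y ω p) with hg₂
  have h1 := integrableOn_and_norm_integral_le_of_supportParams hsupp x y hω (g := g₁)
    (B := ⨆ z, ‖V z‖) (by
      have h := (continuous_focalSum x y).continuousOn (s := Ioi 0)
      have h0 : ∀ p ∈ Ioi (0 : ℝ), focalSum x y p ≠ 0 := fun p hp => (focalSum_pos x y hp).ne'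
      refine ((Complex.continuous_ofReal.comp_continuousOn (continuousOn_id.div h h0)).mul
        hEc.continuousOn).mul (hV.continuous.comp hγ).continuousOn) hV0
    (fun p hp => by
      have hs := focalSum_pos x y hp
      rw [hg₁, norm_mul, norm_mul, Complex.norm_real, Real.norm_of_nonneg (by positivity)]
      have hps : p / focalSum x y p ≤ 1 := div_le_one_of_le₀ (le_focalSum x y p) hs.le
      have : p / focalSum x y p * ‖E p‖ ≤ 1 := mul_le_one₀ hps (norm_nonneg _) (hE1 p)
      exact (mul_le_of_le_one_left (norm_nonneg _) this).trans (le_ciSup hbV _))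
    (fun p hp h => by simp [hg₁, image_eq_zero_of_notMem_tsupport h])
  have h2 := integrableOn_and_norm_integral_le_of_supportParams hsupp x y hω (g := g₂)
    (B := (⨆ z, gradNorm V z) / 2) (by
      refine hEc.continuousOn.mul (ContinuousOn.clm_apply ?_ (continuousOn_hyperbolaVelocity x y ω))
      exact ((hV.continuous_fderiv one_ne_zero).comp hγ).continuousOn) (by positivity)
    (fun p hp => by
      rw [hg₂, norm_mul]
      refine (mul_le_of_le_one_left (norm_nonneg _) (hE1 p)).trans
        ((norm_fderiv_apply_le V _ _).trans ?_)
      rw [div_eq_mul_one_div]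
      gcongr
      · exact le_ciSup hbG _
      · exact norm_hyperbolaVelocity_le x y hω hp)
    (fun p hp h => by
      have : fderiv ℝ V (hyperbola x y ω p) = 0 :=
        image_eq_zero_of_notMem_tsupport fun h' => h (tsupport_fderiv_subset ℝ h')
      simp [hg₂, this])
  have hderiv : ∀ p ∈ Ioi (0 : ℝ), HasDerivAt (fun p => E p * V (hyperbola x y ω p))
      (Complex.I * k * g₁ p + g₂ p) p := by
    intro p hp
    have hE' : HasDerivAt E (E p * (Complex.I * k * ((p / focalSum x y p : ℝ) : ℂ))) p :=
      ((hasDerivAt_focalSum x y hp).ofReal_comp.const_mul (Complex.I * k)).cexp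
    have hV' : HasDerivAt (fun p => V (hyperbola x y ω p))
        (fderiv ℝ V (hyperbola x y ω p) (hyperbolaVelocity x y ω p)) p :=
      ((hV.differentiable one_ne_zero _).hasFDerivAt).comp_hasDerivAt p
        (hasDerivAt_hyperbola x y ω hp)
    refine (hE'.mul hV').congr_deriv ?_
    simp only [hg₁, hg₂]
    ring
  have hlim : Tendsto (fun p => E p * V (hyperbola x y ω p)) atTop (𝓝 0) := by
    refine tendsto_const_nhds.congr' ?_
    have hbdd : BddAbove (supportParams V x y ω) := by
      rcases (supportParams V x y ω).eq_empty_or_nonempty with h | ⟨q, hq⟩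
      · simp [h]
      · refine ⟨q + (2 * diam (tsupport V) + ‖x - y‖), fun p hp => ?_⟩
        linarith [dist_le_of_mem_supportParams hsupp x y hω hp hq, le_abs_self (p - q),
          Real.dist_eq p q]
    obtain ⟨M, hM⟩ := hbdd
    filter_upwards [eventually_gt_atTop M, eventually_gt_atTop 0] with p hpM hp0
    have hp : hyperbola x y ω p ∉ tsupport V := fun h => absurd (hM ⟨hp0, h⟩) hpM.not_ge
    simp [image_eq_zero_of_notMem_tsupport hp]
  have hparts := integral_Ioi_of_hasDerivAt_of_tendsto
    (hEc.mul (hV.continuous.comp hγ)).continuousWithinAt hderiv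
    ((h1.1.const_mul (Complex.I * k)).add h2.1) hlim
  rw [integral_add (h1.1.const_mul _) h2.1, integral_const_mul] at hparts
  simp only [Pi.mul_apply, Function.comp_apply] at hparts
  -- The boundary term at `p = 0` is the value on the segment between the foci.
  have hnorm : ‖k‖ * ‖∫ p in Ioi 0, g₁ p‖ =
      ‖E 0 * V (hyperbola x y ω 0) + ∫ p in Ioi 0, g₂ p‖ := by
    rw [← norm_neg (E 0 * _ + _),
      show -(E 0 * V (hyperbola x y ω 0) + ∫ p in Ioi 0, g₂ p) =
        Complex.I * k * ∫ p in Ioi 0, g₁ p by linear_combination -hparts]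
    simp
  have hF0 : ‖E 0 * V (hyperbola x y ω 0)‖ ≤ ⨆ z, ‖V z‖ := by
    rw [norm_mul]
    exact (mul_le_of_le_one_left (norm_nonneg _) (hE1 0)).trans (le_ciSup hbV _)
  rw [le_div_iff₀ (norm_pos_iff.2 hk0), mul_comm, hnorm]
  exact (norm_add_le _ _).trans (add_le_add hF0 h2.2)

/-- The oscillatory estimate. It is uniform for bounded `|x - y|`. -/
theorem norm_integral_sandwichIntegrand_le_oscillation (hV : ContDiff ℝ 1 V)
    (hsupp : HasCompactSupport V) (hk : 0 < k.im) (x y : Space) :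
    ‖∫ z, sandwichIntegrand k V x y z‖ ≤ 2 * Real.pi *
      (((⨆ z, ‖V z‖) + (⨆ z, gradNorm V z) / 2 * (2 * diam (tsupport V) + ‖x - y‖)) / ‖k‖) := by
  rw [integral_eq_integral_spheroidalMap x y]
  refine (norm_integral_le_of_norm_integral_ray_le (B := 1 / 2 *
      (((⨆ z, ‖V z‖) + (⨆ z, gradNorm V z) / 2 * (2 * diam (tsupport V) + ‖x - y‖)) / ‖k‖))
    fun ω hω => ?_).trans_eq (by ring)
  have hray : ∫ r in Ioi (0 : ℝ), (r ^ 2) • ((‖x - spheroidalMap x y (r • ω)‖ *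
        ‖spheroidalMap x y (r • ω) - y‖ / (2 * ‖r • ω‖ * focalSum x y ‖r • ω‖)) •
        sandwichIntegrand k V x y (spheroidalMap x y (r • ω))) =
      ∫ r in Ioi (0 : ℝ), (1 / 2 : ℂ) * (((r / focalSum x y r : ℝ) : ℂ) *
        Complex.exp (Complex.I * k * (focalSum x y r : ℂ)) * V (hyperbola x y ω r)) := by
    refine setIntegral_congr_fun measurableSet_Ioi fun r hr => ?_
    have hr : 0 < r := hr
    have hω0 : ω ≠ 0 := norm_ne_zero_iff.1 (by simp [hω])
    have hn : ‖r • ω‖ = r := by rw [norm_smul, hω, mul_one, Real.norm_of_nonneg hr.le]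
    have ha := norm_sub_spheroidalMap_pos x y (smul_ne_zero hr.ne' hω0)
    have hb := norm_spheroidalMap_sub_pos x y (smul_ne_zero hr.ne' hω0)
    have hs := focalSum_pos x y hr
    have hsum := norm_add_norm_hyperbola x y hω hr
    simp only [hn, spheroidalMap_smul x y hω hr] at ha hb ⊢
    rw [sandwichIntegrand, ← Complex.exp_add, ← mul_add, ← Complex.ofReal_add, hsum]
    have ha' : ((‖x - hyperbola x y ω r‖ : ℝ) : ℂ) ≠ 0 := Complex.ofReal_ne_zero.2 ha.ne'
    have hb' : ((‖hyperbola x y ω r - y‖ : ℝ) : ℂ) ≠ 0 := Complex.ofReal_ne_zero.2 hb.ne'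
    have hs' : ((focalSum x y r : ℝ) : ℂ) ≠ 0 := Complex.ofReal_ne_zero.2 hs.ne'
    have hr' : ((r : ℝ) : ℂ) ≠ 0 := Complex.ofReal_ne_zero.2 hr.ne'
    simp only [Complex.real_smul]
    push_cast
    field_simp
  rw [hray, integral_const_mul, norm_mul]
  have := norm_integral_hyperbola_le hV hsupp hk x y hω
  norm_num at this ⊢
  linarith

/-! ### The kernel estimate -/

theorem norm_sandwichKernel (k : ℂ) (V : Space → ℂ) (x y : Space) :
    ‖sandwichKernel k V x y‖ =
      1 / (16 * Real.pi ^ 2) * ‖∫ z, sandwichIntegrand k V x y z‖ := by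
  rw [sandwichKernel, norm_mul]
  simp [abs_of_pos Real.pi_pos]

theorem iSup_newtonPotential_le_kernelConstant (V : Space → ℂ) :
    1 / (8 * Real.pi ^ 2) * ⨆ x, newtonPotential V x ≤ kernelConstant V :=
  le_max_left _ _

/-- The weights of the norms of `V` and `∇V` in `kernelConstant` dominate those in the oscillatory
estimate if `|x - y| ≤ t`; the constant in front of the gradient is not sharp. -/
theorem oscillation_le_kernelConstant (V : Space → ℂ) {d t : ℝ} (hd : 0 ≤ d) (hdt : d ≤ t) :
    1 / (8 * Real.pi) *
      ((⨆ z, ‖V z‖) + (⨆ z, gradNorm V z) / 2 * (2 * diam (tsupport V) + d)) ≤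
      (1 + t) * kernelConstant V := by
  have hV0 : 0 ≤ ⨆ z, ‖V z‖ := Real.iSup_nonneg fun _ => norm_nonneg _
  have hG0 : 0 ≤ ⨆ z, gradNorm V z := Real.iSup_nonneg fun _ => gradNorm_nonneg V _
  have hD0 : 0 ≤ diam (tsupport V) := diam_nonneg
  have ht : 0 ≤ t := hd.trans hdt
  have hC := le_max_right (1 / (8 * Real.pi ^ 2) * ⨆ x, newtonPotential V x)
    ((⨆ x, ‖V x‖) / (8 * Real.pi) +
      Real.sqrt 2 / 16 * (⨆ x, gradNorm V x) * (diam (tsupport V) + 1))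
  rw [← kernelConstant] at hC
  refine le_trans ?_ (mul_le_mul_of_nonneg_left hC (by linarith))
  generalize (⨆ z, ‖V z‖) = M at *
  generalize (⨆ z, gradNorm V z) = N at *
  generalize diam (tsupport V) = D at *
  have h2 : 1 ≤ Real.sqrt 2 := Real.one_le_sqrt.2 one_le_two
  have hpi : 1 / (8 * Real.pi) ≤ Real.sqrt 2 / 16 := by
    rw [div_le_div_iff₀ (by positivity) (by norm_num)]
    nlinarith [Real.pi_gt_three]
  have hdiam : (2 * D + d) / 2 ≤ (1 + t) * (D + 1) := by nlinarith [mul_nonneg ht hD0]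
  calc 1 / (8 * Real.pi) * (M + N / 2 * (2 * D + d))
      = M / (8 * Real.pi) + 1 / (8 * Real.pi) * (N * ((2 * D + d) / 2)) := by ring
    _ ≤ (1 + t) * (M / (8 * Real.pi)) + Real.sqrt 2 / 16 * (N * ((1 + t) * (D + 1))) := by
        refine add_le_add (le_mul_of_one_le_left (by positivity) (by linarith)) ?_
        refine mul_le_mul hpi ?_ (by positivity) (by positivity)
        exact mul_le_mul_of_nonneg_left hdiam hG0
    _ = _ := by ring

/-- With `t (t + 1) = |k|`, the estimate without oscillation gives the claim if `|x - y| ≥ t`, and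
the oscillatory estimate does if `|x - y| ≤ t`. -/
theorem norm_sandwichKernel_le (hV : ContDiff ℝ 1 V) (hsupp : HasCompactSupport V)
    (hk : 0 < k.im) (x y : Space) :
    ‖sandwichKernel k V x y‖ ≤ 2 * kernelConstant V / (Real.sqrt (1 + 4 * ‖k‖) - 1) := by
  have hk0 : 0 < ‖k‖ := by
    refine norm_pos_iff.2 ?_
    rintro rfl
    simp at hk
  set t := (Real.sqrt (1 + 4 * ‖k‖) - 1) / 2 with ht
  have ht0 : 0 < t := by
    have : 1 < Real.sqrt (1 + 4 * ‖k‖) := Real.lt_sqrt_of_sq_lt (by linarith)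
    linarith
  have htk : t * (1 + t) = ‖k‖ := by
    have := Real.sq_sqrt (show 0 ≤ 1 + 4 * ‖k‖ by positivity)
    rw [ht]
    linarith
  have hgoal : 2 * kernelConstant V / (Real.sqrt (1 + 4 * ‖k‖) - 1) = kernelConstant V / t := by
    rw [ht]
    field_simp
  rw [hgoal, norm_sandwichKernel]
  have hd := norm_nonneg (x - y)
  rcases le_total t ‖x - y‖ with h | h
  · have hd0 : 0 < ‖x - y‖ := ht0.trans_le h
    obtain ⟨x₀, hx₀⟩ := exists_forall_newtonPotential_le hV.continuous hsupp
    have hbdd : BddAbove (range (newtonPotential V)) := ⟨_, forall_mem_range.2 hx₀⟩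
    have hN := iSup_newtonPotential_le_kernelConstant V
    have hC : 0 ≤ kernelConstant V := by
      refine le_trans ?_ hN
      have := Real.iSup_nonneg fun x => newtonPotential_nonneg V x
      positivity
    calc 1 / (16 * Real.pi ^ 2) * ‖∫ z, sandwichIntegrand k V x y z‖
        ≤ 1 / (16 * Real.pi ^ 2) *
            (((⨆ x, newtonPotential V x) + ⨆ x, newtonPotential V x) / ‖x - y‖) := by
          have := norm_integral_sandwichIntegrand_le_newtonPotential hV.continuous hsupp hk
            (sub_ne_zero.1 (norm_pos_iff.1 hd0))
          refine mul_le_mul_of_nonneg_left (this.trans ?_) (by positivity)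
          gcongr
          · exact le_ciSup hbdd x
          · exact le_ciSup hbdd y
      _ = (1 / (8 * Real.pi ^ 2) * ⨆ x, newtonPotential V x) / ‖x - y‖ := by
          field_simp
          ring
      _ ≤ kernelConstant V / t := by gcongr
  · calc 1 / (16 * Real.pi ^ 2) * ‖∫ z, sandwichIntegrand k V x y z‖
        ≤ 1 / (16 * Real.pi ^ 2) * (2 * Real.pi * (((⨆ z, ‖V z‖) +
            (⨆ z, gradNorm V z) / 2 * (2 * diam (tsupport V) + ‖x - y‖)) / ‖k‖)) := by
          gcongr
          exact norm_integral_sandwichIntegrand_le_oscillation hV hsupp hk x y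
      _ = (1 / (8 * Real.pi) * ((⨆ z, ‖V z‖) +
            (⨆ z, gradNorm V z) / 2 * (2 * diam (tsupport V) + ‖x - y‖))) / ‖k‖ := by
          field_simp
          ring
      _ ≤ (1 + t) * kernelConstant V / ‖k‖ := by
          exact div_le_div_of_nonneg_right (oscillation_le_kernelConstant V hd h) hk0.le
      _ = kernelConstant V / t := by
          rw [← htk]
          field_simp

end Schrodinger

theorem lemma1 (V : Schrodinger.Space → ℂ) (hV : ContDiff ℝ 1 V) (hsupp : HasCompactSupport V) :
    -- the quantities that enter the constant are finite, and the potential attains its maximum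
    ((∀ x, Integrable (fun y => ‖V y‖ / ‖x - y‖)) ∧
      (∃ x₀, ∀ x, Schrodinger.newtonPotential V x ≤ Schrodinger.newtonPotential V x₀) ∧
      BddAbove (Set.range fun x => ‖V x‖) ∧
      BddAbove (Set.range (Schrodinger.gradNorm V))) ∧
    ∀ k : ℂ, 0 < k.im →
      -- the integral that defines the kernel converges
      (∀ x y, Integrable (Schrodinger.sandwichIntegrand k V x y)) ∧
      -- it is the integral kernel of the operator `R₀ V R₀` on `L²`
      (∀ f : Schrodinger.Space → ℂ, MemLp f 2 → ∀ x,
        Integrable (fun y => Schrodinger.freeKernel k x y * f y) ∧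
        Integrable (fun z =>
          Schrodinger.freeKernel k x z * (V z * Schrodinger.freeResolvent k f z)) ∧
        Integrable (fun y => Schrodinger.sandwichKernel k V x y * f y) ∧
        Schrodinger.freeResolvent k (fun z => V z * Schrodinger.freeResolvent k f z) x =
          ∫ y, Schrodinger.sandwichKernel k V x y * f y) ∧
      -- the estimate
      ∀ x y, ‖Schrodinger.sandwichKernel k V x y‖ ≤
        2 * Schrodinger.kernelConstant V / (Real.sqrt (1 + 4 * ‖k‖) - 1) := by
  refine ⟨⟨Schrodinger.integrable_norm_div_norm_sub hV.continuous hsupp,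
    Schrodinger.exists_forall_newtonPotential_le hV.continuous hsupp,
    Schrodinger.bddAbove_range_norm hV.continuous hsupp,
    Schrodinger.bddAbove_range_gradNorm hV hsupp⟩, fun k hk => ⟨?_, ?_, ?_⟩⟩
  · exact Schrodinger.integrable_sandwichIntegrand hV.continuous hsupp hk
  · exact fun f hf x => ⟨Schrodinger.integrable_freeKernel_mul hk hf x,
      Schrodinger.sandwichKernel_spec hV.continuous hsupp hk hf x⟩
  · exact Schrodinger.norm_sandwichKernel_le hV hsupp hk
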